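/- For a finite connected graph $G$ and a function $g$ from the positive integers to $\mathbb{R}$, let $W(G;g)=\sum_{\{u,v\}} g(d_G(u,v))$, where the sum is over all unordered pairs of distinct vertices of $G$ and $d_G$ is the graph distance. For integers $0\le d\le n-1$, let $\mathbf{T}_{d,n}$ be the graph obtained from a path on $d+1$ vertices by attaching $n-d-1$ pendant edges to a centre vertex of the path. Let $T$ be a finite tree with $n$ vertices and diameter $d$, and let $g$ be a nonnegative real-valued function on the positive integers. Then $\mathbf{T}_{d,n}$ is itself a tree (on $n$ vertices) of diameter $d$, and: (a) If $g$ is strictly increasing, then $W(T;g)\ge W(\mathbf{T}_{d,n};g)$, with equality if and only if $T$ is isomorphic to $\mathbf{T}_{d,n}$. (b) If $g$ is strictly decreasing, then $W(T;g)\le W(\mathbf{T}_{d,n};g)$, with equality if and only if $T$ is isomorphic to $\mathbf{T}_{d,n}$. -/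

import Mathlib

/-- The Wiener-type index `W(G; g)`: the sum of `g (d(u, v))` over all unordered pairs `{u, v}` of
distinct vertices of `G`. Only the values of `g` at positive integers matter when `G` is
connected. -/
noncomputable def wienerIndex {V : Type*} [Fintype V] (G : SimpleGraph V) (g : ℕ → ℝ) : ℝ :=
  open Classical in
  ∑ e : Sym2 V with ¬ e.IsDiag,
    Sym2.lift ⟨fun u v => g (G.dist u v), fun u v => by simp only [SimpleGraph.dist_comm]⟩ e

/-- The tree on the vertices `0, …, n - 1` (for `d + 1 ≤ n`) that consists of the path
`0, 1, …, d` of order `d + 1` and of the `n - d - 1` further vertices `d + 1, …, n - 1`, each of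
them joined by a pendant edge to the centre vertex `⌊d / 2⌋` of the path. -/
def centreTree (d n : ℕ) : SimpleGraph (Fin n) :=
  SimpleGraph.fromRel fun i j : Fin n =>
    ((i : ℕ) + 1 = (j : ℕ) ∧ (j : ℕ) ≤ d) ∨ ((i : ℕ) = d / 2 ∧ d < (j : ℕ))

section

open Finset

/-! ### Sums over a path -/

/-! Every tree on `n` vertices has exactly `n - 1` pairs at distance 1, so `g` may be replaced by `G
k = g (max k 2)` at a cost depending only on `n` (`wienerIndex_eq_max_two`). For increasing `g`, `G`
is monotone and smallest at 1 and 2. Number the vertices so that `0, …, d` is a diametral path.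
Pairs on the path contribute equally to both trees. A vertex off the path sees it at distances `h +
|i - j|` with `h ≥ 1`, and the sum of `G` over these is least for `h = 1` and `i` central
(`sum_centre_le_sum_profile`). Two vertices off the path contribute at least `G 2`, their exact
contribution in the extremal tree. Equality attaches every other vertex to a centre of the path, at
mutual distances at most 2, which forces a common centre. The decreasing case is the increasing one
for `-g`. -/

theorem sum_abs_sub_eq (F : ℕ → ℝ) {d i : ℕ} (hi : i ≤ d) :
    ∑ j ∈ range (d + 1), F ((i - j) + (j - i)) =
      ∑ m ∈ range (i + 1), F m + ∑ m ∈ range (d - i), F (m + 1) := by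
  have h : d + 1 = (i + 1) + (d - i) := by omega
  rw [h, sum_range_add, ← sum_range_reflect F (i + 1)]
  congr 1
  · refine sum_congr rfl fun j hj => ?_
    rw [mem_range] at hj
    congr 1; omega
  · refine sum_congr rfl fun j hj => ?_
    congr 1; omega

/-- Moving the base point from `i` to `i + 1` trades one distance `d - i` for one distance `i + 1`.
Before the middle this is no loss, so the sum decreases towards the centre. -/
theorem sum_abs_sub_succ (F : ℕ → ℝ) {d i : ℕ} (hi : i < d) :
    ∑ j ∈ range (d + 1), F ((i - j) + (j - i)) + F (i + 1) =
      ∑ j ∈ range (d + 1), F ((i + 1 - j) + (j - (i + 1))) + F (d - i) := by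
  rw [sum_abs_sub_eq F hi.le, sum_abs_sub_eq F (i := i + 1) hi, sum_range_succ _ (i + 1)]
  obtain ⟨k, rfl⟩ := Nat.exists_eq_add_of_lt hi
  have h1 : i + k + 1 - i = k + 1 := by omega
  have h2 : i + k + 1 - (i + 1) = k := by omega
  rw [h1, h2, sum_range_succ _ k]
  ring

theorem sum_abs_sub_reflect (F : ℕ → ℝ) {d i : ℕ} (hi : i ≤ d) :
    ∑ j ∈ range (d + 1), F ((d - i - j) + (j - (d - i))) =
      ∑ j ∈ range (d + 1), F ((i - j) + (j - i)) := by
  rw [← sum_range_reflect]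
  refine sum_congr rfl fun j hj => ?_
  rw [mem_range] at hj
  congr 1; omega

theorem sum_centre_le_of_le {F : ℕ → ℝ} (hF : Monotone F) {d i : ℕ} (hi : i ≤ d / 2) :
    ∑ j ∈ range (d + 1), F ((d / 2 - j) + (j - d / 2)) ≤
      ∑ j ∈ range (d + 1), F ((i - j) + (j - i)) := by
  induction hi using Nat.decreasingInduction with
  | self => exact le_rfl
  | of_succ k hk ih =>
    have h := sum_abs_sub_succ F (show k < d by omega)
    have := hF (show k + 1 ≤ d - k by omega)
    linarith

theorem sum_centre_le {F : ℕ → ℝ} (hF : Monotone F) {d i : ℕ} (hi : i ≤ d) :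
    ∑ j ∈ range (d + 1), F ((d / 2 - j) + (j - d / 2)) ≤
      ∑ j ∈ range (d + 1), F ((i - j) + (j - i)) := by
  rcases le_or_gt i (d / 2) with h | h
  · exact sum_centre_le_of_le hF h
  · rw [← sum_abs_sub_reflect F hi]
    exact sum_centre_le_of_le hF (by omega)

/-- Strictness from 1 on is what survives in the application, where `F m = G (1 + m)` and `G` is
flat up to 2. -/
theorem sum_centre_lt_of_lt {F : ℕ → ℝ} (hF : Monotone F) (hF' : StrictMonoOn F (Set.Ici 1))
    {d i : ℕ} (hi : i < d / 2) :
    ∑ j ∈ range (d + 1), F ((d / 2 - j) + (j - d / 2)) <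
      ∑ j ∈ range (d + 1), F ((i - j) + (j - i)) := by
  have h := sum_abs_sub_succ F (show i < d by omega)
  have h1 := sum_centre_le_of_le hF (show i + 1 ≤ d / 2 by omega)
  have h2 := hF' (show 1 ≤ i + 1 by omega) (show 1 ≤ d - i by omega) (show i + 1 < d - i by omega)
  linarith

theorem eq_centre_of_sum_le {F : ℕ → ℝ} (hF : Monotone F) (hF' : StrictMonoOn F (Set.Ici 1))
    {d i : ℕ} (hi : i ≤ d)
    (h : ∑ j ∈ range (d + 1), F ((i - j) + (j - i)) ≤
      ∑ j ∈ range (d + 1), F ((d / 2 - j) + (j - d / 2))) :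
    i = d / 2 ∨ i = d - d / 2 := by
  by_contra! hne
  rcases lt_or_gt_of_ne hne.1 with h1 | h1
  · exact absurd (sum_centre_lt_of_lt hF hF' h1) (not_lt.2 h)
  · have := sum_centre_lt_of_lt hF hF' (d := d) (i := d - i) (by omega)
    rw [sum_abs_sub_reflect F hi] at this
    exact absurd this (not_lt.2 h)

/-! ### Distance profiles along a path -/

section Profile

variable {G : ℕ → ℝ} {d i h : ℕ}

theorem sum_centre_le_sum_profile (hG : Monotone G) (hi : i ≤ d) (hh : 1 ≤ h) :
    ∑ j ∈ range (d + 1), G (1 + ((d / 2 - j) + (j - d / 2))) ≤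
      ∑ j ∈ range (d + 1), G (h + ((i - j) + (j - i))) :=
  (sum_centre_le (F := fun m => G (1 + m)) (fun a b hab => hG (by omega)) hi).trans
    (sum_le_sum fun j _ => hG (by omega))

theorem eq_centre_of_sum_profile_le (hG : Monotone G) (hG' : StrictMonoOn G (Set.Ici 2))
    (hd : 1 ≤ d) (hi : i ≤ d) (hh : 1 ≤ h)
    (hle : ∑ j ∈ range (d + 1), G (h + ((i - j) + (j - i))) ≤
      ∑ j ∈ range (d + 1), G (1 + ((d / 2 - j) + (j - d / 2)))) :
    h = 1 ∧ (i = d / 2 ∨ i = d - d / 2) := by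
  have hF : Monotone fun m => G (1 + m) := fun a b hab => hG (by omega)
  have hF' : StrictMonoOn (fun m => G (1 + m)) (Set.Ici 1) := fun a ha b hb hab =>
    hG' (by simp only [Set.mem_Ici] at *; omega) (by simp only [Set.mem_Ici] at *; omega)
      (by omega)
  have h1 : h = 1 := by
    by_contra hne
    -- Some path vertex `k` differs from `i`, as `d ≥ 1`; there `1 + |i - k| ≥ 2`, so `G` detects `h
    -- > 1`. At `k = i` it might not, since only strictness from 2 on is known.
    obtain ⟨k, hk, hik⟩ : ∃ k, k ≤ d ∧ 1 ≤ (i - k) + (k - i) := by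
      rcases Nat.eq_zero_or_pos i with h0 | h0
      · exact ⟨d, le_rfl, by omega⟩
      · exact ⟨0, by omega, by omega⟩
    have hlt : ∑ j ∈ range (d + 1), G (1 + ((i - j) + (j - i))) <
        ∑ j ∈ range (d + 1), G (h + ((i - j) + (j - i))) :=
      sum_lt_sum (fun j _ => hG (by omega)) ⟨k, by simp; omega,
        hG' (by simp only [Set.mem_Ici]; omega) (by simp only [Set.mem_Ici]; omega) (by omega)⟩
    have := sum_centre_le hF hi
    linarith
  subst h1
  exact ⟨rfl, eq_centre_of_sum_le hF hF' hi hle⟩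

end Profile

/-- Without a peak, a sequence with steps `±1` descends and then ascends; `i` is the turning point.
-/
theorem exists_profile_of_no_local_max (x : ℕ → ℕ) (d : ℕ)
    (hstep : ∀ j < d, x (j + 1) = x j + 1 ∨ x j = x (j + 1) + 1)
    (hmax : ∀ j, j + 2 ≤ d → ¬ (x (j + 1) = x j + 1 ∧ x (j + 1) = x (j + 2) + 1)) :
    ∃ i ≤ d, ∀ j ≤ d, x j = x i + ((i - j) + (j - i)) := by
  induction d with
  | zero => exact ⟨0, le_rfl, fun j hj => by obtain rfl : j = 0 := by omega
                                             simp⟩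
  | succ d ih =>
    obtain ⟨i, hi, h⟩ := ih (fun j hj => hstep j (by omega)) (fun j hj => hmax j (by omega))
    have hd := h d le_rfl
    rcases hstep d (by omega) with h1 | h1
    · refine ⟨i, by omega, fun j hj => ?_⟩
      rcases Nat.lt_or_ge d j with hj' | hj'
      · obtain rfl : j = d + 1 := by omega
        omega
      · exact h j hj'
    · rcases Nat.lt_or_ge i d with hid | hid
      · obtain ⟨k, rfl⟩ : ∃ k, d = k + 1 := ⟨d - 1, by omega⟩
        have h2 := h k (by omega)
        exact absurd ⟨by omega, h1⟩ (hmax k (by omega))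
      · obtain rfl : i = d := by omega
        refine ⟨i + 1, le_rfl, fun j hj => ?_⟩
        rcases Nat.lt_or_ge i j with hj' | hj'
        · obtain rfl : j = i + 1 := by omega
          omega
        · have := h j hj'
          omega

/-! ### Distances in trees -/

namespace SimpleGraph

variable {V : Type*} {T : SimpleGraph V}

/-- Prolonging geodesics from `b` and `c` to `v` by the edges at `a` gives two paths from `a` to
`v`, which must coincide. -/
theorem IsTree.eq_of_adj_of_dist (hT : T.IsTree) {v a b c : V} (hab : T.Adj a b)
    (hac : T.Adj a c) (hb : T.dist v a = T.dist v b + 1) (hc : T.dist v a = T.dist v c + 1) :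
    b = c := by
  obtain ⟨p, hp⟩ := hT.connected.exists_walk_length_eq_dist b v
  obtain ⟨q, hq⟩ := hT.connected.exists_walk_length_eq_dist c v
  have hp' : (Walk.cons hab p).IsPath := Walk.isPath_of_length_eq_dist _ (by
    rw [Walk.length_cons, hp, dist_comm, ← hb, dist_comm])
  have hq' : (Walk.cons hac q).IsPath := Walk.isPath_of_length_eq_dist _ (by
    rw [Walk.length_cons, hq, dist_comm, ← hc, dist_comm])
  have := (hT.existsUnique_path a v).unique hp' hq'
  simpa using congrArg Walk.snd this

/-- At a peak of the distance to `v`, a vertex would have two distinct neighbours closer to `v`. -/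
theorem IsTree.exists_profile (hT : T.IsTree) (p : ℕ → V) (d : ℕ)
    (hadj : ∀ j < d, T.Adj (p j) (p (j + 1))) (hne : ∀ j, j + 2 ≤ d → p j ≠ p (j + 2)) (v : V) :
    ∃ i ≤ d, ∀ j ≤ d, T.dist v (p j) = T.dist v (p i) + ((i - j) + (j - i)) := by
  refine exists_profile_of_no_local_max (fun j => T.dist v (p j)) d (fun j hj => ?_)
    (fun j hj h => ?_)
  · have := hT.dist_eq_dist_add_one_of_adj v (hadj j hj)
    omega
  · exact hne j hj (hT.eq_of_adj_of_dist (hadj j (by omega)).symm (hadj (j + 1) (by omega)) h.1 h.2)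

theorem dist_getVert_of_length_eq_dist (hT : T.Connected) {u v : V} {p : T.Walk u v}
    (hp : p.length = T.dist u v) {i j : ℕ} (hij : i ≤ j) (hj : j ≤ p.length) :
    T.dist (p.getVert i) (p.getVert j) = j - i := by
  have key : ∀ a b, a ≤ b → T.dist (p.getVert a) (p.getVert b) ≤ b - a := by
    intro a b hab
    obtain ⟨k, rfl⟩ := Nat.exists_eq_add_of_le hab
    have h : ((p.drop a).take k).length ≤ k := by
      rw [Walk.take_length]; omega
    have h' := (dist_le _).trans h
    rw [p.drop_getVert a k] at h'
    omega
  have h1 := key 0 i (by omega)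
  have h2 := key i j hij
  have h3 := key j p.length hj
  rw [Walk.getVert_zero] at h1
  rw [Walk.getVert_length] at h3
  have h4 := hT.dist_triangle (u := u) (v := p.getVert i) (w := v)
  have h5 := hT.dist_triangle (u := p.getVert i) (v := p.getVert j) (w := v)
  omega

/-- A function that behaves like a distance towards `v` is the distance towards `v`. -/
theorem reachable_and_dist_eq {G : SimpleGraph V} (v : V) (D : V → ℕ) (hv : D v = 0)
    (hadj : ∀ u w, G.Adj u w → D u ≤ D w + 1)
    (hdesc : ∀ u, u ≠ v → ∃ w, G.Adj u w ∧ D u = D w + 1) (u : V) :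
    G.Reachable u v ∧ G.dist u v = D u := by
  have hlow : ∀ {u : V} (p : G.Walk u v), D u ≤ p.length := by
    intro u p
    induction p with
    | nil => simp [hv]
    | cons h p ih =>
      have := hadj _ _ h
      have := ih hv hdesc
      rw [Walk.length_cons]
      omega
  have hup : ∀ k u, D u = k → ∃ p : G.Walk u v, p.length = k := by
    intro k
    induction k with
    | zero =>
      intro u hu
      by_cases h : u = v
      · subst h; exact ⟨Walk.nil, rfl⟩
      · obtain ⟨w, -, hw⟩ := hdesc u h
        omega
    | succ k ih =>
      intro u hu
      by_cases h : u = v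
      · subst h; omega
      · obtain ⟨w, hw, hD⟩ := hdesc u h
        obtain ⟨p, hp⟩ := ih w (by omega)
        exact ⟨Walk.cons hw p, by simp [hp]⟩
  obtain ⟨p, hp⟩ := hup _ u rfl
  have hr : G.Reachable u v := ⟨p⟩
  refine ⟨hr, le_antisymm (hp ▸ dist_le p) ?_⟩
  obtain ⟨q, hq⟩ := hr.exists_walk_length_eq_dist
  exact hq ▸ hlow q

theorem Iso.dist_eq {V' : Type*} {G : SimpleGraph V} {G' : SimpleGraph V'} (f : G ≃g G')
    (u v : V) : G'.dist (f u) (f v) = G.dist u v := by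
  by_cases h : G.Reachable u v
  · apply le_antisymm
    · obtain ⟨p, hp⟩ := h.exists_walk_length_eq_dist
      rw [← hp, ← Walk.length_map f.toHom p]
      exact dist_le _
    · obtain ⟨p, hp⟩ := (f.reachable_iff.2 h).exists_walk_length_eq_dist
      have := dist_le (p.map f.symm.toHom)
      rw [Walk.length_map, hp] at this
      simpa using this
  · rw [dist_eq_zero_of_not_reachable h,
      dist_eq_zero_of_not_reachable (fun h' => h (f.reachable_iff.1 h'))]

end SimpleGraph

/-! ### The index -/

section Index

variable {V : Type*} [Fintype V]

open Classical in
theorem wienerIndex_congr (G : SimpleGraph V) (hG : G.Connected) {f g : ℕ → ℝ}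
    (h : ∀ k, 1 ≤ k → f k = g k) : wienerIndex G f = wienerIndex G g := by
  unfold wienerIndex
  refine sum_congr rfl fun e he => ?_
  induction e with | _ u v
  simp only [mem_filter, mem_univ, true_and, Sym2.mk_isDiag_iff] at he
  exact h _ (hG.pos_dist_of_ne he)

theorem wienerIndex_add (G : SimpleGraph V) (f g : ℕ → ℝ) :
    wienerIndex G (fun k => f k + g k) = wienerIndex G f + wienerIndex G g := by
  unfold wienerIndex
  rw [← sum_add_distrib]
  refine sum_congr rfl fun e he => ?_
  induction e with | _ u v
  rfl

theorem wienerIndex_const_mul (G : SimpleGraph V) (c : ℝ) (g : ℕ → ℝ) :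
    wienerIndex G (fun k => c * g k) = c * wienerIndex G g := by
  unfold wienerIndex
  rw [mul_sum]
  refine sum_congr rfl fun e he => ?_
  induction e with | _ u v
  rfl

theorem SimpleGraph.Iso.wienerIndex_eq {V' : Type*} [Fintype V'] {G : SimpleGraph V}
    {G' : SimpleGraph V'} (φ : G ≃g G') (g : ℕ → ℝ) : wienerIndex G g = wienerIndex G' g := by
  unfold wienerIndex
  refine sum_nbij' (Sym2.map φ) (Sym2.map φ.symm) (fun e he => ?_) (fun e he => ?_)
    (fun e he => ?_) (fun e he => ?_) (fun e he => ?_)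
  all_goals induction e with | _ u v
  · simpa using he
  · simpa using he
  · simp
  · simp
  · simp [φ.dist_eq]

open Classical in
theorem SimpleGraph.IsTree.wienerIndex_indicator_one {T : SimpleGraph V} (hT : T.IsTree) :
    wienerIndex T (fun k => if k = 1 then 1 else 0) = (Fintype.card V : ℝ) - 1 := by
  have h : wienerIndex T (fun k => if k = 1 then 1 else 0) = (T.edgeFinset.card : ℝ) := by
    have h1 : T.edgeFinset = ({e : Sym2 V | ¬ e.IsDiag} : Finset _).filter (· ∈ T.edgeSet) := by
      ext e
      simp only [SimpleGraph.mem_edgeFinset, mem_filter, mem_univ, true_and]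
      exact ⟨fun h => ⟨T.not_isDiag_of_mem_edgeSet h, h⟩, fun h => h.2⟩
    rw [h1, ← sum_boole]
    unfold wienerIndex
    refine sum_congr rfl fun e _ => ?_
    induction e with | _ u v
    simp [SimpleGraph.dist_eq_one_iff_adj]
  rw [h, ← hT.card_edgeFinset]
  simp

/-- In a tree, the values `g 1` and `g 2` may be identified at the cost of a term that depends
only on the order. -/
theorem SimpleGraph.IsTree.wienerIndex_eq_max_two {T : SimpleGraph V} (hT : T.IsTree)
    (g : ℕ → ℝ) : wienerIndex T g =
      wienerIndex T (fun k => g (max k 2)) + (g 1 - g 2) * ((Fintype.card V : ℝ) - 1) := by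
  rw [← hT.wienerIndex_indicator_one, ← wienerIndex_const_mul, ← wienerIndex_add]
  refine wienerIndex_congr T hT.connected fun k hk => ?_
  rcases Nat.lt_or_ge k 2 with h | h
  · obtain rfl : k = 1 := by omega
    simp
  · rw [max_eq_left h, if_neg (by omega)]
    ring

end Index

/-- Charging each pair to its larger vertex lets the trees be compared vertex by vertex, with the
path numbered first. -/
theorem wienerIndex_fin {n : ℕ} (G : SimpleGraph (Fin n)) (g : ℕ → ℝ) :
    wienerIndex G g = ∑ v : Fin n, ∑ u : Fin n with u < v, g (G.dist u v) := by
  classical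
  unfold wienerIndex
  have h := sum_sym2_filter_not_isDiag (univ : Finset (Fin n))
    (Sym2.lift ⟨fun u v => g (G.dist u v), fun u v => by simp only [SimpleGraph.dist_comm]⟩)
  rw [sym2_univ] at h
  refine (Eq.trans (by congr!) h).trans ?_
  simp only [sum_filter, Sym2.lift_mk]
  rw [sum_comm, ← sum_product', ← sum_filter, ← sum_filter]
  refine sum_congr ?_ fun _ _ => rfl
  ext ⟨a, b⟩
  simp only [mem_filter, mem_product, mem_univ, mem_offDiag, true_and]
  exact ⟨fun h => h.2, fun h => ⟨h.ne, h⟩⟩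

/-! ### The extremal tree -/

theorem centreTree_adj {d n : ℕ} (i j : Fin n) : (centreTree d n).Adj i j ↔
    ((i : ℕ) + 1 = j ∧ (j : ℕ) ≤ d) ∨ ((i : ℕ) = d / 2 ∧ d < (j : ℕ)) ∨
    ((j : ℕ) + 1 = i ∧ (i : ℕ) ≤ d) ∨ ((j : ℕ) = d / 2 ∧ d < (i : ℕ)) := by
  rw [centreTree, SimpleGraph.fromRel_adj, Ne, Fin.ext_iff]
  omega

/-- The distance in `centreTree d n`. -/
def centreDist (d u v : ℕ) : ℕ :=
  if u = v then 0
  else if u ≤ d then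
    if v ≤ d then (u - v) + (v - u) else 1 + ((d / 2 - u) + (u - d / 2))
  else if v ≤ d then 1 + ((d / 2 - v) + (v - d / 2)) else 2

theorem centreTree_reachable_and_dist {d n : ℕ} (hd : d < n) (u v : Fin n) :
    (centreTree d n).Reachable u v ∧ (centreTree d n).dist u v = centreDist d u v := by
  refine SimpleGraph.reachable_and_dist_eq v (fun u => centreDist d u v) (by simp [centreDist])
    (fun u w h => ?_) (fun u hu => ?_) u
  · rw [centreTree_adj] at h
    simp only [centreDist]
    split_ifs <;> omega
  · obtain ⟨w, hw, h⟩ : ∃ w, w < n ∧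
        ((((u : ℕ) + 1 = w ∧ (w : ℕ) ≤ d) ∨ ((u : ℕ) = d / 2 ∧ d < (w : ℕ)) ∨
          ((w : ℕ) + 1 = u ∧ (u : ℕ) ≤ d) ∨ ((w : ℕ) = d / 2 ∧ d < (u : ℕ))) ∧
          centreDist d u v = centreDist d w v + 1) := by
      have hu' : (u : ℕ) ≠ v := fun h => hu (Fin.ext h)
      have hv := v.2
      have hun := u.2
      simp only [centreDist]
      by_cases h1 : (u : ℕ) ≤ d
      · by_cases h2 : (v : ℕ) ≤ d
        · rcases Nat.lt_or_ge u v with h3 | h3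
          · exact ⟨u + 1, by omega, by omega, by split_ifs <;> omega⟩
          · exact ⟨u - 1, by omega, by omega, by split_ifs <;> omega⟩
        · rcases Nat.lt_trichotomy u (d / 2) with h3 | h3 | h3
          · exact ⟨u + 1, by omega, by omega, by split_ifs <;> omega⟩
          · exact ⟨v, by omega, by omega, by split_ifs <;> omega⟩
          · exact ⟨u - 1, by omega, by omega, by split_ifs <;> omega⟩
      · exact ⟨d / 2, by omega, by omega, by split_ifs <;> omega⟩
    exact ⟨⟨w, hw⟩, (centreTree_adj _ _).2 h.1, h.2⟩

theorem centreTree_dist {d n : ℕ} (hd : d < n) (u v : Fin n) :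
    (centreTree d n).dist u v = centreDist d u v :=
  (centreTree_reachable_and_dist hd u v).2

theorem centreTree_isTree {d n : ℕ} (hd : d < n) : (centreTree d n).IsTree := by
  classical
  have : NeZero n := ⟨by omega⟩
  have hconn : (centreTree d n).Connected :=
    (SimpleGraph.connected_iff _).2 ⟨fun u v => (centreTree_reachable_and_dist hd u v).1, ⟨0⟩⟩
  rw [SimpleGraph.isTree_iff_connected_and_card]
  refine ⟨hconn, le_antisymm ?_ hconn.card_vert_le_card_edgeSet_add_one⟩
  -- `q j` is the parent of `j` for the root 0. Every edge joins some `j ≠ 0` to its parent, so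
  -- there are at most `n - 1` edges.
  let q : Fin n → Fin n := fun j => if (j : ℕ) ≤ d then ⟨j - 1, by omega⟩ else ⟨d / 2, by omega⟩
  have hsub : (centreTree d n).edgeFinset ⊆ (univ.erase 0).image fun j => s(q j, j) := by
    intro e he
    induction e with | _ a b
    rw [SimpleGraph.mem_edgeFinset, SimpleGraph.mem_edgeSet, centreTree_adj] at he
    simp only [mem_image, mem_erase, mem_univ, and_true, Sym2.eq_iff, Ne, Fin.ext_iff,
      Fin.val_zero, q]
    by_cases h : ((a : ℕ) + 1 = b ∧ (b : ℕ) ≤ d) ∨ ((a : ℕ) = d / 2 ∧ d < (b : ℕ))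
    · refine ⟨b, by omega, Or.inl ⟨?_, rfl⟩⟩
      split_ifs <;> simp only [] <;> omega
    · refine ⟨a, by omega, Or.inr ⟨?_, rfl⟩⟩
      split_ifs <;> simp only [] <;> omega
  have hcard := (card_le_card hsub).trans card_image_le
  rw [card_erase_of_mem (mem_univ _), card_univ, Fintype.card_fin] at hcard
  rw [Nat.card_eq_fintype_card, Nat.card_eq_fintype_card, Fintype.card_fin,
    ← SimpleGraph.edgeFinset_card]
  omega

/-- For `d ≤ 1`, any pendant vertex would raise the diameter above `d`. -/
theorem centreTree_diam {d n : ℕ} (hd : d < n) (h : 2 ≤ d ∨ n = d + 1) :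
    (centreTree d n).diam = d := by
  have : Nonempty (Fin n) := ⟨⟨0, by omega⟩⟩
  apply le_antisymm
  · obtain ⟨u, v, huv⟩ := (centreTree d n).exists_dist_eq_diam
    have hu := u.2
    have hv := v.2
    rw [← huv, centreTree_dist hd, centreDist]
    split_ifs <;> omega
  · have h1 := SimpleGraph.dist_le_diam
      (SimpleGraph.connected_iff_ediam_ne_top.1 (centreTree_isTree hd).connected)
      (u := (⟨0, by omega⟩ : Fin n)) (v := ⟨d, hd⟩)
    rw [centreTree_dist hd, centreDist] at h1
    simp only [Nat.zero_le, le_refl, if_true] at h1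
    split_ifs at h1 <;> omega

/-! ### Comparison with the extremal tree -/

section Comparison

open SimpleGraph

variable {n d : ℕ} {T : SimpleGraph (Fin n)}

theorem sum_initial_segment (hd : d < n) (f : Fin n → ℝ) (f' : ℕ → ℝ)
    (h : ∀ i : Fin n, (i : ℕ) ≤ d → f i = f' i) :
    ∑ i : Fin n with i.val ≤ d, f i = ∑ j ∈ range (d + 1), f' j := by
  refine sum_bij (fun i _ => (i : ℕ)) (fun i hi => ?_) (fun i _ j _ hij => Fin.ext hij)
    (fun j hj => ?_) (fun i hi => h i (by simpa using hi))
  · simp only [mem_filter, mem_univ, true_and] at hi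
    exact mem_range.2 (by omega)
  · rw [mem_range] at hj
    exact ⟨⟨j, by omega⟩, by simp; omega, rfl⟩

/-- The first `d + 1` vertices form a geodesic path. -/
def IsGeodesicSegment (T : SimpleGraph (Fin n)) (d : ℕ) : Prop :=
  ∀ i j : Fin n, (i : ℕ) ≤ d → (j : ℕ) ≤ d → T.dist i j = (i - j) + (j - i)

theorem IsGeodesicSegment.exists_profile (hT : T.IsTree) (hd : d < n)
    (hP : IsGeodesicSegment T d) (v : Fin n) :
    ∃ i : Fin n, (i : ℕ) ≤ d ∧
      ∀ j : Fin n, (j : ℕ) ≤ d → T.dist v j = T.dist v i + ((i - j) + (j - i)) := by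
  let p : ℕ → Fin n := fun j => if h : j < n then ⟨j, h⟩ else v
  have hp : ∀ j (h : j < n), p j = ⟨j, h⟩ := fun j h => dif_pos h
  obtain ⟨i, hi, h⟩ := hT.exists_profile p d (fun j hj => by
      rw [hp j (by omega), hp (j + 1) (by omega), ← dist_eq_one_iff_adj,
        hP _ _ (by simp only []; omega) (by simp only []; omega)]
      simp only []
      omega) (fun j hj => by
      rw [hp j (by omega), hp (j + 2) (by omega), Ne, Fin.ext_iff]
      simp only []
      omega) v
  refine ⟨⟨i, by omega⟩, hi, fun j hj => ?_⟩
  have := h j hj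
  rwa [hp j j.2, hp i (by omega)] at this

theorem IsGeodesicSegment.sum_centre_le (hT : T.IsTree) (hd : d < n)
    (hP : IsGeodesicSegment T d) {G : ℕ → ℝ} (hG : Monotone G) {v : Fin n} (hv : d < (v : ℕ)) :
    ∑ i : Fin n with i.val ≤ d, G ((centreTree d n).dist i v) ≤
      ∑ i : Fin n with i.val ≤ d, G (T.dist i v) := by
  obtain ⟨i, hi, h⟩ := hP.exists_profile hT hd v
  rw [sum_initial_segment hd _ (fun j => G (1 + ((d / 2 - j) + (j - d / 2)))),
    sum_initial_segment hd _ (fun j => G (T.dist v i + ((i - j) + (j - i))))]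
  · exact sum_centre_le_sum_profile hG hi
      (hT.connected.pos_dist_of_ne (fun h => by rw [h] at hv; omega))
  · intro j hj
    rw [dist_comm, h j hj]
  · intro j hj
    rw [centreTree_dist hd, centreDist, if_neg (by omega), if_pos hj, if_neg (by omega)]

theorem IsGeodesicSegment.adj_centre_of_sum_le (hT : T.IsTree) (hd : d < n) (hd1 : 1 ≤ d)
    (hP : IsGeodesicSegment T d) {G : ℕ → ℝ} (hG : Monotone G)
    (hG' : StrictMonoOn G (Set.Ici 2)) {v : Fin n} (hv : d < (v : ℕ))
    (hle : ∑ i : Fin n with i.val ≤ d, G (T.dist i v) ≤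
      ∑ i : Fin n with i.val ≤ d, G ((centreTree d n).dist i v)) :
    ∃ i : Fin n, ((i : ℕ) = d / 2 ∨ (i : ℕ) = d - d / 2) ∧ T.Adj v i ∧
      ∀ j : Fin n, (j : ℕ) ≤ d → T.dist v j = 1 + ((i - j) + (j - i)) := by
  obtain ⟨i, hi, h⟩ := hP.exists_profile hT hd v
  rw [sum_initial_segment hd _ (fun j => G (T.dist v i + ((i - j) + (j - i)))),
    sum_initial_segment hd _ (fun j => G (1 + ((d / 2 - j) + (j - d / 2))))] at hle
  · obtain ⟨h1, h2⟩ := eq_centre_of_sum_profile_le hG hG' hd1 hi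
      (hT.connected.pos_dist_of_ne (fun h => by rw [h] at hv; omega)) hle
    exact ⟨i, h2, dist_eq_one_iff_adj.1 h1, fun j hj => by rw [h j hj, h1]⟩
  · intro j hj
    rw [centreTree_dist hd, centreDist, if_neg (by omega), if_pos hj, if_neg (by omega)]
  · intro j hj
    rw [dist_comm, h j hj]

theorem IsGeodesicSegment.sum_lt_eq (hd : d < n) (hP : IsGeodesicSegment T d) (G : ℕ → ℝ)
    {v : Fin n} (hv : (v : ℕ) ≤ d) :
    ∑ u : Fin n with u < v, G (T.dist u v) =
      ∑ u : Fin n with u < v, G ((centreTree d n).dist u v) := by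
  refine sum_congr rfl fun u hu => ?_
  have hu' : (u : ℕ) < v := by simpa using hu
  rw [hP u v (by omega) hv, centreTree_dist hd, centreDist, if_neg (by omega),
    if_pos (by omega), if_pos hv]

theorem sum_lt_eq_add {v : Fin n} (hv : d < (v : ℕ)) (f : Fin n → ℝ) :
    ∑ u : Fin n with u < v, f u = ∑ u : Fin n with u.val ≤ d, f u +
      ∑ u : Fin n with d < u.val ∧ u < v, f u := by
  rw [← sum_filter_add_sum_filter_not _ (fun u : Fin n => (u : ℕ) ≤ d), filter_filter,
    filter_filter]
  congr 2
  · ext u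
    simp only [mem_filter, mem_univ, true_and, Fin.lt_def]
    omega
  · ext u
    simp only [mem_filter, mem_univ, true_and, Fin.lt_def]
    omega

theorem centreTree_dist_le_of_lt (hd : d < n) (hT : T.Connected) {G : ℕ → ℝ}
    (hG2 : ∀ k, 1 ≤ k → G 2 ≤ G k) {u v : Fin n} (hu : d < (u : ℕ)) (huv : u < v) :
    G ((centreTree d n).dist u v) ≤ G (T.dist u v) := by
  have h : (centreTree d n).dist u v = 2 := by
    have : (u : ℕ) < v := huv
    rw [centreTree_dist hd, centreDist, if_neg (by omega), if_neg (by omega), if_neg (by omega)]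
  rw [h]
  exact hG2 _ (hT.pos_dist_of_ne huv.ne)

theorem IsGeodesicSegment.sum_lt_le (hT : T.IsTree) (hd : d < n) (hP : IsGeodesicSegment T d)
    {G : ℕ → ℝ} (hG : Monotone G) (hG2 : ∀ k, 1 ≤ k → G 2 ≤ G k) (v : Fin n) :
    ∑ u : Fin n with u < v, G ((centreTree d n).dist u v) ≤
      ∑ u : Fin n with u < v, G (T.dist u v) := by
  rcases Nat.lt_or_ge d v with hv | hv
  · rw [sum_lt_eq_add hv, sum_lt_eq_add hv]
    refine add_le_add (hP.sum_centre_le hT hd hG hv) (sum_le_sum fun u hu => ?_)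
    simp only [mem_filter, mem_univ, true_and] at hu
    exact centreTree_dist_le_of_lt hd hT.connected hG2 hu.1 hu.2
  · exact (hP.sum_lt_eq hd G hv).ge

theorem IsGeodesicSegment.wienerIndex_le_of_monotone (hT : T.IsTree) (hd : d < n)
    (hP : IsGeodesicSegment T d) {G : ℕ → ℝ} (hG : Monotone G)
    (hG2 : ∀ k, 1 ≤ k → G 2 ≤ G k) :
    wienerIndex (centreTree d n) G ≤ wienerIndex T G := by
  rw [wienerIndex_fin, wienerIndex_fin]
  exact sum_le_sum fun v _ => hP.sum_lt_le hT hd hG hG2 v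

/-- In the case of equality, the vertices off the path are adjacent to a centre of the path and
are at distance at most `2` from each other. -/
theorem IsGeodesicSegment.adj_centre_of_wienerIndex_le (hT : T.IsTree) (hd : d < n)
    (hd1 : 1 ≤ d) (hP : IsGeodesicSegment T d) {G : ℕ → ℝ} (hG : Monotone G)
    (hG' : StrictMonoOn G (Set.Ici 2)) (hG2 : ∀ k, 1 ≤ k → G 2 ≤ G k)
    (hle : wienerIndex T G ≤ wienerIndex (centreTree d n) G) :
    (∀ v : Fin n, d < (v : ℕ) → ∃ i : Fin n, ((i : ℕ) = d / 2 ∨ (i : ℕ) = d - d / 2) ∧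
      T.Adj v i ∧ ∀ j : Fin n, (j : ℕ) ≤ d → T.dist v j = 1 + ((i - j) + (j - i))) ∧
    ∀ u v : Fin n, d < (u : ℕ) → u < v → T.dist u v ≤ 2 := by
  have hv : ∀ v : Fin n, ∑ u : Fin n with u < v, G ((centreTree d n).dist u v) =
      ∑ u : Fin n with u < v, G (T.dist u v) := by
    rw [wienerIndex_fin, wienerIndex_fin] at hle
    have := (sum_eq_sum_iff_of_le fun v _ => hP.sum_lt_le hT hd hG hG2 v).1
      (le_antisymm (sum_le_sum fun v _ => hP.sum_lt_le hT hd hG hG2 v) hle)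
    exact fun v => this v (mem_univ v)
  have hsum : ∀ v : Fin n, ∀ u ∈ ({u : Fin n | d < (u : ℕ) ∧ u < v} : Finset (Fin n)),
      G ((centreTree d n).dist u v) ≤ G (T.dist u v) := fun v u hu => by
    simp only [mem_filter, mem_univ, true_and] at hu
    exact centreTree_dist_le_of_lt hd hT.connected hG2 hu.1 hu.2
  refine ⟨fun v hdv => hP.adj_centre_of_sum_le hT hd hd1 hG hG' hdv ?_, fun u v hdu huv => ?_⟩
  · have h := hv v
    rw [sum_lt_eq_add hdv, sum_lt_eq_add hdv] at h
    have := sum_le_sum (hsum v)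
    linarith
  · have huv' : (u : ℕ) < v := huv
    have hdv : d < (v : ℕ) := by omega
    have h := hv v
    rw [sum_lt_eq_add hdv, sum_lt_eq_add hdv] at h
    have h1 := hP.sum_centre_le hT hd hG hdv
    have h2 := (sum_eq_sum_iff_of_le (hsum v)).1
      (le_antisymm (sum_le_sum (hsum v)) (by linarith)) u (by simp [hdu, huv])
    have h3 : (centreTree d n).dist u v = 2 := by
      rw [centreTree_dist hd, centreDist, if_neg (by omega), if_neg (by omega),
        if_neg (by omega)]
    rw [h3] at h2
    by_contra! h4
    exact absurd h2 (hG' (by simp) (by simp only [Set.mem_Ici]; omega) h4).ne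

theorem IsGeodesicSegment.adj_succ (hP : IsGeodesicSegment T d) {i j : Fin n}
    (hj : (j : ℕ) ≤ d) (hij : (i : ℕ) + 1 = j) : T.Adj i j := by
  rw [← dist_eq_one_iff_adj, hP i j (by omega) hj]
  omega

/-- Distinct neighbours of the two ends of an edge are at distance greater than `2`. -/
theorem two_lt_dist_of_adj_ends (hT : T.IsTree)
    {u v i j : Fin n} (hij : T.Adj i j) (hui : T.dist u i = 1) (huj : T.dist u j = 2)
    (hvj : T.Adj v j) (hvi : v ≠ i) (huv : u ≠ v) : 2 < T.dist u v := by
  have h := hT.dist_eq_dist_add_one_of_adj u hvj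
  have := hT.connected.pos_dist_of_ne huv
  by_contra! h2
  exact hvi (hT.eq_of_adj_of_dist (v := u) hvj.symm hij.symm (by omega) (by omega))

/-- The hypotheses place the extremal tree inside `T`, and a tree is a minimal connected graph. -/
theorem eq_centreTree_of_adj (hT : T.IsTree) (hd : d < n) (hP : IsGeodesicSegment T d)
    (h : ∀ u v : Fin n, (u : ℕ) = d / 2 → d < (v : ℕ) → T.Adj u v) : T = centreTree d n := by
  have hle : centreTree d n ≤ T := by
    intro i j hij
    rw [centreTree_adj] at hij
    rcases hij with hij | hij | hij | hij
    · exact hP.adj_succ hij.2 hij.1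
    · exact h i j hij.1 hij.2
    · exact (hP.adj_succ hij.2 hij.1).symm
    · exact (h j i hij.1 hij.2).symm
  exact le_antisymm
    ((isTree_iff_minimal_connected.1 hT).2 (centreTree_isTree hd).connected hle) hle

/-- The reversal of the path `0, …, d` in `Fin n`. -/
def reversePath (hd : d < n) : Fin n ≃ Fin n :=
  Function.Involutive.toPerm
    (fun i => if (i : ℕ) ≤ d then ⟨d - i, by omega⟩ else i) fun i => by
      apply Fin.ext
      by_cases h : (i : ℕ) ≤ d
      · simp only [h, if_true, Nat.sub_le]
        omega
      · simp [h]

theorem reversePath_of_le (hd : d < n) {i : Fin n} (h : (i : ℕ) ≤ d) :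
    ((reversePath hd i : Fin n) : ℕ) = d - i := by
  change ((if (i : ℕ) ≤ d then ⟨d - i, by omega⟩ else i : Fin n) : ℕ) = d - i
  rw [if_pos h]

theorem reversePath_of_lt (hd : d < n) {i : Fin n} (h : d < (i : ℕ)) :
    reversePath hd i = i := by
  change (if (i : ℕ) ≤ d then ⟨d - i, by omega⟩ else i : Fin n) = i
  rw [if_neg (by omega)]

/-- Reversing the path exchanges `d / 2` and `d - d / 2`, which handles the second centre when `d`
is odd. -/
theorem nonempty_iso_centreTree_of_adj_reverse (hT : T.IsTree) (hd : d < n)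
    (hP : IsGeodesicSegment T d)
    (h : ∀ u v : Fin n, (u : ℕ) = d - d / 2 → d < (v : ℕ) → T.Adj u v) :
    Nonempty (T ≃g centreTree d n) := by
  let φ : T.comap (reversePath hd) ≃g T := Iso.comap (reversePath hd) T
  have hφ : ∀ i, φ i = reversePath hd i := fun _ => rfl
  have h1 : T.comap (reversePath hd) = centreTree d n := by
    refine eq_centreTree_of_adj (φ.isTree_iff.2 hT) hd (fun i j hi hj => ?_) (fun u v hu hv => ?_)
    · rw [← φ.dist_eq, hφ, hφ, hP _ _ (by rw [reversePath_of_le hd hi]; omega)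
        (by rw [reversePath_of_le hd hj]; omega), reversePath_of_le hd hi, reversePath_of_le hd hj]
      omega
    · rw [comap_adj, reversePath_of_lt hd hv]
      exact h _ _ (by rw [reversePath_of_le hd (by omega), hu]) hv
  rw [← h1]
  exact ⟨φ.symm⟩

theorem IsGeodesicSegment.nonempty_iso_of_wienerIndex_le (hT : T.IsTree) (hd : d < n)
    (hd1 : 1 ≤ d) (hP : IsGeodesicSegment T d) {G : ℕ → ℝ} (hG : Monotone G)
    (hG' : StrictMonoOn G (Set.Ici 2)) (hG2 : ∀ k, 1 ≤ k → G 2 ≤ G k)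
    (hle : wienerIndex T G ≤ wienerIndex (centreTree d n) G) :
    Nonempty (T ≃g centreTree d n) := by
  obtain ⟨h1, h2⟩ := hP.adj_centre_of_wienerIndex_le hT hd hd1 hG hG' hG2 hle
  have h2' : ∀ u v : Fin n, d < (u : ℕ) → d < (v : ℕ) → T.dist u v ≤ 2 := by
    intro u v hu hv
    rcases lt_trichotomy u v with h | rfl | h
    · exact h2 u v hu h
    · simp
    · rw [dist_comm]; exact h2 v u hv h
  by_cases hall : ∀ v : Fin n, d < (v : ℕ) → ∀ u : Fin n, (u : ℕ) = d / 2 → T.Adj v u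
  · rw [eq_centreTree_of_adj hT hd hP fun u v hu hv => (hall v hv u hu).symm]
    exact ⟨Iso.refl⟩
  · push Not at hall
    obtain ⟨w, hw, c, hc, hwc⟩ := hall
    obtain ⟨c', hc', hwc', -⟩ := h1 w hw
    have hcc : (c : ℕ) ≠ c' := fun h => hwc (Fin.ext h ▸ hwc')
    refine nonempty_iso_centreTree_of_adj_reverse hT hd hP fun b v hb hv => ?_
    obtain ⟨i, hi, hvi, hvd⟩ := h1 v hv
    by_cases hib : i = b
    · exact hib ▸ hvi.symm
    -- Here `v` hangs at `d / 2` and `w` at `d - d / 2`; these centres are distinct, hence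
    -- consecutive, so `v` and `w` are more than 2 apart.
    · exfalso
      have hib' : (i : ℕ) ≠ b := fun h => hib (Fin.ext h)
      have hadj : T.Adj i c' := hP.adj_succ (by omega) (by omega)
      have hvi1 := hvd i (by omega)
      have hvc' := hvd c' (by omega)
      have := two_lt_dist_of_adj_ends hT hadj (u := v) (v := w) (by omega) (by omega) hwc'
        (fun h => by rw [h] at hw; omega) (fun h => by
          rw [← h, ← dist_eq_one_iff_adj] at hwc'
          omega)
      have := h2' v w hv hw
      omega

end Comparison

/-! ### Numbering along a diametral path, and the main comparison -/

section Main

open SimpleGraph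

theorem SimpleGraph.IsTree.exists_geodesic_numbering {V : Type*} [Fintype V] {T : SimpleGraph V}
    {n d : ℕ} (hT : T.IsTree) (hn : Fintype.card V = n) (hd : T.diam = d) :
    d < n ∧ ∃ e : Fin n ≃ V, IsGeodesicSegment (T.comap e) d := by
  classical
  have := hT.connected.nonempty
  obtain ⟨u, v, huv⟩ := T.exists_dist_eq_diam
  obtain ⟨p, hp⟩ := hT.connected.exists_walk_length_eq_dist u v
  have hlen : p.length = d := by rw [hp, huv, hd]
  have hdn : d < n := by
    rw [← hn, ← hlen]
    exact (p.isPath_of_length_eq_dist hp).length_lt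
  have hdist : ∀ i j, i ≤ d → j ≤ d → T.dist (p.getVert i) (p.getVert j) = (i - j) + (j - i) := by
    intro i j hi hj
    rcases le_total i j with h | h
    · rw [dist_getVert_of_length_eq_dist hT.connected hp h (by omega)]
      omega
    · rw [dist_comm, dist_getVert_of_length_eq_dist hT.connected hp h (by omega)]
      omega
  obtain ⟨e, he⟩ := Set.MapsTo.exists_equiv_extend_of_card_eq (α := Fin n) (t := (univ : Finset V))
    (by simp [hn]) (s := {i : Fin n | i.val ≤ d}) (f := fun i => p.getVert i)
    (fun _ _ => by simp) (fun i hi j hj hij => by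
      have h := hdist i j hi hj
      simp only [] at hij
      rw [hij, dist_self] at h
      exact Fin.ext (by omega))
  let e' : Fin n ≃ V := e.trans (Equiv.subtypeUnivEquiv fun x => mem_univ x)
  refine ⟨hdn, e', fun i j hi hj => ?_⟩
  have h := (Iso.comap e' T).dist_eq i j
  rw [← h, ← hdist i j hi hj]
  have hi' : (Iso.comap e' T) i = p.getVert i := he i hi
  have hj' : (Iso.comap e' T) j = p.getVert j := he j hj
  rw [hi', hj']

/-- Diameter at most 1 makes all vertices mutually adjacent, and a tree has no triangle. -/
theorem SimpleGraph.IsTree.two_le_diam_or_card_eq {V : Type*} [Fintype V] {T : SimpleGraph V}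
    {n d : ℕ} (hT : T.IsTree) (hn : Fintype.card V = n) (hd : T.diam = d) :
    2 ≤ d ∨ n = d + 1 := by
  classical
  by_contra! h
  obtain ⟨hdn, e, -⟩ := hT.exists_geodesic_numbering hn hd
  have := hT.connected.nonempty
  have hle : ∀ u v, T.dist u v ≤ 1 := fun u v =>
    (dist_le_diam (connected_iff_ediam_ne_top.1 hT.connected)).trans (by omega)
  have hadj : ∀ u v, u ≠ v → T.dist u v = 1 := fun u v huv =>
    le_antisymm (hle u v) (hT.connected.pos_dist_of_ne huv)
  have hd0 : d ≠ 0 := by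
    intro h0
    have h1 := dist_le_diam (connected_iff_ediam_ne_top.1 hT.connected)
      (u := e ⟨0, by omega⟩) (v := e ⟨1, by omega⟩)
    rw [hadj _ _ (fun h => by simpa using e.injective h)] at h1
    omega
  have h01 := hadj (e ⟨0, by omega⟩) (e ⟨1, by omega⟩) (fun h => by simpa using e.injective h)
  have h02 := hadj (e ⟨0, by omega⟩) (e ⟨2, by omega⟩) (fun h => by simpa using e.injective h)
  have h12 := hadj (e ⟨1, by omega⟩) (e ⟨2, by omega⟩) (fun h => by simpa using e.injective h)
  exact hT.dist_ne_of_adj _ (dist_eq_one_iff_adj.1 h12) (h01.trans h02.symm)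

theorem wienerIndex_centreTree_le_of_strictMonoOn {V : Type*} [Fintype V] {T : SimpleGraph V}
    {n d : ℕ} (hT : T.IsTree) (hn : Fintype.card V = n) (hd : T.diam = d) {g : ℕ → ℝ}
    (hg : StrictMonoOn g (Set.Ici 1)) :
    wienerIndex (centreTree d n) g ≤ wienerIndex T g ∧
      (wienerIndex T g = wienerIndex (centreTree d n) g ↔ Nonempty (T ≃g centreTree d n)) := by
  obtain ⟨hdn, e, hP⟩ := hT.exists_geodesic_numbering hn hd
  have hT' : (T.comap e).IsTree := (Iso.comap e T).isTree_iff.2 hT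
  have hC := centreTree_isTree hdn
  set G : ℕ → ℝ := fun k => g (max k 2) with hGdef
  have hG : Monotone G := fun a b hab => hg.monotoneOn (by simp) (by simp) (by omega)
  have hG' : StrictMonoOn G (Set.Ici 2) := fun a ha b hb hab => by
    simp only [Set.mem_Ici] at ha hb
    exact hg (by simp) (by simp) (by omega)
  have hG2 : ∀ k, 1 ≤ k → G 2 ≤ G k := fun k _ =>
    hg.monotoneOn (by simp) (by simp) (by omega)
  have h1 := hT'.wienerIndex_eq_max_two g
  have h2 := hC.wienerIndex_eq_max_two g
  rw [← hGdef] at h1 h2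
  rw [(Iso.comap e T).wienerIndex_eq g] at h1
  refine ⟨?_, fun h => ?_, fun ⟨φ⟩ => φ.wienerIndex_eq g⟩
  · have := hP.wienerIndex_le_of_monotone hT' hdn hG hG2
    linarith
  · by_cases hd1 : 1 ≤ d
    · obtain ⟨φ⟩ := hP.nonempty_iso_of_wienerIndex_le hT' hdn hd1 hG hG' hG2 (by linarith)
      exact ⟨(Iso.comap e T).symm.trans φ⟩
    -- For `d = 0` the tree is a single vertex, and no vertex lies off the path.
    · have hn1 : n = d + 1 := (hT.two_le_diam_or_card_eq hn hd).resolve_left (by omega)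
      rw [← eq_centreTree_of_adj hT' hdn hP fun u v _ hv => absurd v.2 (by omega)]
      exact ⟨(Iso.comap e T).symm⟩

end Main

end

theorem theorem4 {V : Type*} [Fintype V] (T : SimpleGraph V) (n d : ℕ)
    (hT : T.IsTree) (hn : Fintype.card V = n) (hd : T.diam = d)
    (g : ℕ → ℝ) (hg : ∀ k : ℕ, 1 ≤ k → 0 ≤ g k) :
    ((centreTree d n).IsTree ∧ (centreTree d n).diam = d) ∧
    (StrictMonoOn g (Set.Ici 1) →
      wienerIndex (centreTree d n) g ≤ wienerIndex T g ∧
      (wienerIndex T g = wienerIndex (centreTree d n) g ↔ Nonempty (T ≃g centreTree d n))) ∧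
    (StrictAntiOn g (Set.Ici 1) →
      wienerIndex T g ≤ wienerIndex (centreTree d n) g ∧
      (wienerIndex T g = wienerIndex (centreTree d n) g ↔ Nonempty (T ≃g centreTree d n))) := by
  have hdn := (hT.exists_geodesic_numbering hn hd).1
  refine ⟨⟨centreTree_isTree hdn, centreTree_diam hdn (hT.two_le_diam_or_card_eq hn hd)⟩,
    wienerIndex_centreTree_le_of_strictMonoOn hT hn hd, fun hg' => ?_⟩
  -- The index is linear in `g`, so negation reverses the inequality and preserves the equality
  -- case.
  have h := wienerIndex_centreTree_le_of_strictMonoOn hT hn hd (g := fun k => -1 * g k)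
    fun a ha b hb hab => by
      have := hg' ha hb hab
      simp only []
      linarith
  rw [wienerIndex_const_mul, wienerIndex_const_mul] at h
  refine ⟨by linarith [h.1], ?_⟩
  rw [← h.2]
  constructor <;> intro h' <;> linarith
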